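/- There is an absolute constant $s_0$ with the following property. Let $K$ be a number field with exactly $s$ real embeddings $\sigma_1,\dots,\sigma_s$ and exactly $t$ pairs of complex conjugate non-real embeddings $\tau_1,\overline{\tau_1},\dots,\tau_t,\overline{\tau_t}$, and suppose that $s\ge s_0$ and $$t\le 0.096\,\sqrt{s/\log s}.$$ Let $\psi=(\sigma_1,\dots,\sigma_s,\tau_1,\dots,\tau_t):K\to\mathbb R^s\times\mathbb C^t$, where the target carries the Euclidean norm $\|(x,z)\|^2=\sum_{i=1}^s x_i^2+\sum_{j=1}^t|z_j|^2$. Let $\Lambda_K=\psi(\mathcal O_K)$ be the image of the ring of integers $\mathcal O_K$ of $K$, and let $d(\Lambda_K)$ be the minimum of $\|x\|$ over the nonzero $x\in\Lambda_K$. Put $m(K)=d(\Lambda_K)^2/(s+t)$. Then the minimum is attained, and $$m(K)=1,\qquad\text{i.e.}\qquad d(\Lambda_K)^2=s+t.$$ Moreover, if $\alpha\in\mathcal O_K\setminus\{0\}$ satisfies $\|\psi(\alpha)\|=d(\Lambda_K)$, then $\alpha=\pm1$ or $K=\mathbb Q(\alpha)$. -/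

import Mathlib

open NumberField NumberField.InfinitePlace

universe u

noncomputable section

/-- The embedding `ψ : K → ℝ ^ s × ℂ ^ t` given by the real embeddings and by one embedding from
each pair of complex conjugate ones, with values in the mixed space carrying its Euclidean norm
`‖(x, z)‖ ^ 2 = ∑ x_i ^ 2 + ∑ |z_j| ^ 2`. -/
def vectorEmbedding (K : Type*) [Field K] [NumberField K] (a : K) :
    mixedEmbedding.euclidean.mixedSpace K :=
  (mixedEmbedding.euclidean.toMixed K).symm (mixedEmbedding K a)

/-- The set of points of the lattice `Λ_K = ψ(𝓞 K)`. -/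
def fieldLattice (K : Type*) [Field K] [NumberField K] :
    Set (mixedEmbedding.euclidean.mixedSpace K) :=
  Set.range fun a : 𝓞 K => vectorEmbedding K (a : K)

open scoped Classical in
/-- The relative size `‖a‖_K = ‖ψ(a)‖` of `a`, the Euclidean length of the vector `ψ(a)`. -/
def relSize (K : Type*) [Field K] [NumberField K] (a : K) : ℝ :=
  ‖vectorEmbedding K a‖

open scoped Classical in
/-- The set of lengths of the nonzero vectors of `Λ_K`. -/
def latticeLengths (K : Type*) [Field K] [NumberField K] : Set ℝ :=
  {r : ℝ | ∃ x ∈ fieldLattice K, x ≠ 0 ∧ r = ‖x‖}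

/-- The minimum distance `d(Λ_K)`: the length of the shortest nonzero vector of `Λ_K`. -/
def latticeMinDist (K : Type*) [Field K] [NumberField K] : ℝ :=
  sInf (latticeLengths K)

/-- The normalised quantity `m(K) = d(Λ_K) ^ 2 / (s + t)`. -/
def normalisedMin (K : Type*) [Field K] [NumberField K] : ℝ :=
  latticeMinDist K ^ 2 / ((nrRealPlaces K : ℝ) + (nrComplexPlaces K : ℝ))

end

namespace NumberField

/-! If `a ≠ 0, ±1`, then `a` and `a ^ 2 - 1` are nonzero integers, so both norms are at least 1 in
absolute value. Hence `∑ (|a|_w ^ 2 - 1)` only decreases when `2 log |N a|` and `(1/10) log |N (a ^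
2 - 1)|` are subtracted. Split over places, the result is at least `3/50` at each real place and
`-2` at each complex one, so it is positive once `100 t < 3 s` (`relSize_sq_gt`). The bound on `t`
gives this for `s ≥ 100`. -/

/-- The auxiliary inequality at a real place, away from the point `x = 1`. -/
theorem auxiliary_real_le {x : ℝ} (hx : 0 < x) (hx1 : x ≠ 1) :
    3 / 50 ≤ x - 1 - Real.log x - 1 / 10 * Real.log |x - 1| := by
  have hlog2 := Real.log_two_gt_d9
  have hpos : 0 < |x - 1| := abs_pos.mpr (sub_ne_zero.mpr hx1)
  rcases le_or_gt x (1 / 2) with h | h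
  · have h1 : Real.log |x - 1| ≤ 0 :=
      Real.log_nonpos (abs_nonneg _) (abs_le.mpr ⟨by linarith, by linarith⟩)
    have h2 := Real.log_le_sub_one_of_pos (show 0 < 2 * x by linarith)
    rw [Real.log_mul two_ne_zero hx.ne'] at h2
    linarith
  rcases le_or_gt x (3 / 2) with h' | h'
  · have h1 : Real.log |x - 1| ≤ Real.log (1 / 2) :=
      Real.log_le_log hpos (abs_le.mpr ⟨by linarith, by linarith⟩)
    rw [one_div, Real.log_inv] at h1
    have h2 := Real.log_le_sub_one_of_pos hx
    linarith
  · have h1 := Real.log_le_sub_one_of_pos hpos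
    rw [abs_of_pos (show 0 < x - 1 by linarith)] at h1 ⊢
    have h2 := Real.log_le_sub_one_of_pos (show 0 < x / 2 by linarith)
    rw [Real.log_div hx.ne' two_ne_zero] at h2
    -- Tangent to `log` at `3 / 2`; the next two bounds give `log (3 / 2) ≤ 1 / 5 + 1 / 4`.
    have h3 := Real.log_le_sub_one_of_pos (show 0 < x / (3 / 2) by positivity)
    have h4 := Real.log_le_sub_one_of_pos (show (0 : ℝ) < 3 / 2 / (5 / 4) by norm_num)
    have h5 := Real.log_le_sub_one_of_pos (show (0 : ℝ) < 5 / 4 by norm_num)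
    rw [Real.log_div hx.ne' (by norm_num)] at h3
    rw [Real.log_div (by norm_num) (by norm_num)] at h4
    linarith

/-- The auxiliary inequality at a complex place. -/
theorem auxiliary_complex_le {y z : ℝ} (hy : 0 < y) (hz : 0 < z) (hzy : z ≤ y + 1) :
    -2 ≤ y - 1 - 2 * Real.log y - 1 / 10 * (2 * Real.log z) := by
  have h1 := Real.log_le_sub_one_of_pos hz
  -- The tangent at `4` has slope `1 / 4`, so `y` still dominates `2 log y + (1 / 5) log z`.
  have h2 := Real.log_le_sub_one_of_pos (show 0 < y / 2 / 2 by positivity)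
  rw [Real.log_div (by positivity) two_ne_zero, Real.log_div hy.ne' two_ne_zero] at h2
  linarith [Real.log_two_lt_d9]

variable {K : Type*} [Field K] [NumberField K]

open scoped Classical in
theorem relSize_nonneg (a : K) : 0 ≤ relSize K a :=
  norm_nonneg (vectorEmbedding K a)

theorem relSize_sq (a : K) : relSize K a ^ 2 = ∑ w : InfinitePlace K, w a ^ 2 := by
  classical
  rw [InfinitePlace.sum_eq_sum_add_sum]
  refine (WithLp.prod_norm_sq_eq_of_L2 (vectorEmbedding K a)).trans ?_
  rw [EuclideanSpace.norm_sq_eq, EuclideanSpace.norm_sq_eq]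
  congr 1
  · refine Finset.sum_congr rfl fun w _ => ?_
    rw [← norm_embedding_of_isReal w.2]
    rfl
  · refine Finset.sum_congr rfl fun w _ => ?_
    rw [← norm_embedding_eq]
    rfl

theorem relSize_sq_one :
    relSize K (1 : K) ^ 2 = (nrRealPlaces K : ℝ) + (nrComplexPlaces K : ℝ) := by
  rw [relSize_sq]
  simp [card_eq_nrRealPlaces_add_nrComplexPlaces]

/-- The logarithmic form of the fact that a nonzero algebraic integer has norm at least `1`. -/
theorem sum_mult_mul_log_nonneg {a : 𝓞 K} (ha : a ≠ 0) :
    0 ≤ ∑ w : InfinitePlace K, (w.mult : ℝ) * Real.log (w (a : K)) := by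
  have ha' : (a : K) ≠ 0 := RingOfIntegers.coe_ne_zero_iff.mpr ha
  have h : ∑ w : InfinitePlace K, (w.mult : ℝ) * Real.log (w (a : K)) =
      Real.log |(Algebra.norm ℚ (a : K) : ℝ)| := by
    have := prod_eq_abs_norm (a : K)
    push_cast at this
    rw [← this, Real.log_prod fun w _ => pow_ne_zero _ ((map_ne_zero w).mpr ha')]
    simp_rw [Real.log_pow]
  rw [h, ← Algebra.coe_norm_int]
  refine Real.log_nonneg ?_
  have : 1 ≤ |Algebra.norm ℤ a| := Int.one_le_abs (Algebra.norm_ne_zero_iff.mpr ha)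
  exact_mod_cast this

/-- A nonzero algebraic integer other than `±1` in a field with few complex places has a longer
vector than `1`. -/
theorem relSize_sq_gt {a : 𝓞 K} (ha : a ≠ 0) (h1 : a ≠ 1) (hn1 : a ≠ -1)
    (hst : 100 * (nrComplexPlaces K : ℝ) < 3 * nrRealPlaces K) :
    (nrRealPlaces K : ℝ) + nrComplexPlaces K < relSize K (a : K) ^ 2 := by
  classical
  have hb : a ^ 2 - 1 ≠ 0 := by
    rw [sub_ne_zero, Ne, sq_eq_one_iff]
    tauto
  have ha' : (a : K) ≠ 0 := RingOfIntegers.coe_ne_zero_iff.mpr ha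
  have hb' : (a : K) ^ 2 - 1 ≠ 0 := by
    simpa using RingOfIntegers.coe_ne_zero_iff.mpr hb
  have hNa := sum_mult_mul_log_nonneg ha
  have hNb := sum_mult_mul_log_nonneg hb
  have hcoe : ((a ^ 2 - 1 : 𝓞 K) : K) = (a : K) ^ 2 - 1 := by simp
  rw [hcoe] at hNb
  rw [sum_eq_sum_add_sum] at hNa hNb
  rw [relSize_sq, sum_eq_sum_add_sum]
  simp only [mult_isReal, mult_isComplex, Nat.cast_one, Nat.cast_ofNat, one_mul] at hNa hNb
  have hreal : ∑ _w : {w : InfinitePlace K // IsReal w}, (3 / 50 : ℝ) ≤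
      ∑ w : {w : InfinitePlace K // IsReal w}, (w.1 (a : K) ^ 2 - 1 - 2 * Real.log (w.1 (a : K))
        - 1 / 10 * Real.log (w.1 ((a : K) ^ 2 - 1))) := by
    refine Finset.sum_le_sum fun w _ => ?_
    have e1 : w.1 (a : K) ^ 2 = embedding_of_isReal w.2 (a : K) ^ 2 := by
      rw [← norm_embedding_of_isReal w.2, Real.norm_eq_abs, sq_abs]
    -- Using `a ^ 2 - 1` makes the real term a function of `x = |a|_w ^ 2` alone.
    have e2 : w.1 ((a : K) ^ 2 - 1) = |w.1 (a : K) ^ 2 - 1| := by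
      rw [e1, ← norm_embedding_of_isReal w.2, Real.norm_eq_abs, map_sub, map_pow, map_one]
    have hpos : 0 < w.1 (a : K) := pos_iff.mpr ha'
    have hne : 0 < w.1 ((a : K) ^ 2 - 1) := pos_iff.mpr hb'
    rw [e2] at hne ⊢
    have := auxiliary_real_le (pow_pos hpos 2) (sub_ne_zero.mp (abs_pos.mp hne))
    rwa [Real.log_pow, Nat.cast_ofNat] at this
  have hcomplex : ∑ _w : {w : InfinitePlace K // IsComplex w}, (-2 : ℝ) ≤
      ∑ w : {w : InfinitePlace K // IsComplex w}, (w.1 (a : K) ^ 2 - 1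
        - 2 * (2 * Real.log (w.1 (a : K)))
        - 1 / 10 * (2 * Real.log (w.1 ((a : K) ^ 2 - 1)))) := by
    refine Finset.sum_le_sum fun w _ => ?_
    have hpos : 0 < w.1 (a : K) := pos_iff.mpr ha'
    have hle : w.1 ((a : K) ^ 2 - 1) ≤ w.1 (a : K) ^ 2 + 1 := by
      rw [← norm_embedding_eq, ← norm_embedding_eq, map_sub, map_pow, map_one, ← norm_pow]
      simpa only [norm_one] using norm_sub_le (w.1.embedding (a : K) ^ 2) 1
    have := auxiliary_complex_le (pow_pos hpos 2) (pos_iff.mpr hb') hle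
    rwa [Real.log_pow, Nat.cast_ofNat] at this
  simp only [Finset.sum_sub_distrib, ← Finset.mul_sum, Finset.sum_const, Finset.card_univ,
    nsmul_eq_mul, mul_one] at hreal hcomplex hNa hNb
  linarith

/-- If the field has few complex places, `ψ(1)` is a shortest nonzero vector of the lattice. -/
theorem relSize_one_le {a : 𝓞 K} (ha : a ≠ 0)
    (hst : 100 * (nrComplexPlaces K : ℝ) < 3 * nrRealPlaces K) :
    relSize K (1 : K) ≤ relSize K (a : K) := by
  by_cases h1 : a = 1
  · simp [h1]
  by_cases hn1 : a = -1
  · refine le_of_sq_le_sq ?_ (relSize_nonneg _)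
    rw [relSize_sq, relSize_sq]
    refine Finset.sum_le_sum fun w _ => ?_
    rw [← norm_embedding_eq, ← norm_embedding_eq]
    simp [hn1]
  · refine le_of_sq_le_sq ?_ (relSize_nonneg _)
    rw [relSize_sq_one]
    exact (relSize_sq_gt ha h1 hn1 hst).le

theorem isLeast_latticeLengths (hst : 100 * (nrComplexPlaces K : ℝ) < 3 * nrRealPlaces K) :
    IsLeast (latticeLengths K) (relSize K (1 : K)) := by
  have hinj : ∀ a : 𝓞 K, vectorEmbedding K (a : K) ≠ 0 ↔ a ≠ 0 := fun a => by
    simp [vectorEmbedding]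
  constructor
  · exact ⟨_, ⟨1, rfl⟩, (hinj 1).mpr one_ne_zero, by simp [relSize]⟩
  · rintro _ ⟨_, ⟨a, rfl⟩, h0, rfl⟩
    exact relSize_one_le ((hinj a).mp h0) hst

theorem complexPlaces_lt_of_le_sqrt {s t : ℝ} (hs : 100 ≤ s)
    (ht : t ≤ 0.096 * Real.sqrt (s / Real.log s)) : 100 * t < 3 * s := by
  have hlog : 1 ≤ Real.log s := by
    rw [Real.le_log_iff_exp_le (by linarith)]
    linarith [Real.exp_one_lt_d9]
  -- Since `s ≥ 100`, `s ≤ (s / 10) ^ 2`; hence `100 t ≤ 0.96 s`.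
  have hsqrt : Real.sqrt (s / Real.log s) ≤ s / 10 := by
    refine Real.sqrt_le_iff.mpr ⟨by linarith, (div_le_self (by linarith) hlog).trans ?_⟩
    nlinarith
  norm_num at ht
  linarith

end NumberField

theorem theorem3p3 :
    ∃ s₀ : ℕ, ∀ (K : Type u) [Field K] [NumberField K],
      s₀ ≤ nrRealPlaces K →
      (nrComplexPlaces K : ℝ) ≤
        0.096 * Real.sqrt ((nrRealPlaces K : ℝ) / Real.log (nrRealPlaces K : ℝ)) →
      normalisedMin K = 1 ∧
      latticeMinDist K ^ 2 = (nrRealPlaces K : ℝ) + (nrComplexPlaces K : ℝ) ∧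
      IsLeast (latticeLengths K) (latticeMinDist K) ∧
      ∀ a : 𝓞 K, a ≠ 0 → relSize K (a : K) = latticeMinDist K →
        a = 1 ∨ a = -1 ∨ IntermediateField.adjoin ℚ {(a : K)} = ⊤ := by
  refine ⟨100, fun K _ _ hs ht => ?_⟩
  have hst := complexPlaces_lt_of_le_sqrt (by exact_mod_cast hs) ht
  have hleast := isLeast_latticeLengths hst
  have hd : latticeMinDist K = relSize K (1 : K) := hleast.csInf_eq
  have hsq : latticeMinDist K ^ 2 = (nrRealPlaces K : ℝ) + (nrComplexPlaces K : ℝ) := by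
    rw [hd, relSize_sq_one]
  have hs' : (100 : ℝ) ≤ nrRealPlaces K := by exact_mod_cast hs
  refine ⟨?_, hsq, hd ▸ hleast, fun a ha hmin => ?_⟩
  · rw [normalisedMin, hsq, div_self (by positivity)]
  -- Strictness in `relSize_sq_gt` leaves only `±1` as minimisers, so the alternative `K = ℚ(a)` is
  -- never needed.
  · by_contra! h
    have := relSize_sq_gt ha h.1 h.2.1 hst
    rw [hmin, hsq] at this
    exact this.false
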